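/- Let $G$ be an infinite Abelian group. Then there are a faithfully indexed sequence $(x_n)_{n<\omega}$ in $G$ (that is, $x_m\neq x_n$ whenever $m\neq n$) and a family $\mathcal{B}$ of Hausdorff totally bounded group topologies on $G$ with $|\mathcal{B}|=2^{2^{|G|}}$ such that 1. $x_n\to 0_G$ in $(G,\mathcal{T})$ for every $\mathcal{T}\in\mathcal{B}$; 2. $w(G,\mathcal{T})=2^{|G|}$ for every $\mathcal{T}\in\mathcal{B}$; and 3. for distinct $\mathcal{T}_0,\mathcal{T}_1\in\mathcal{B}$ the topological spaces $(G,\mathcal{T}_0)$ and $(G,\mathcal{T}_1)$ are not homeomorphic. Here a group topology $\mathcal{T}$ on $G$ is totally bounded if for every nonempty $U\in\mathcal{T}$ there is a finite set $F\subseteq G$ with $G=F+U$, and the weight $w(G,\mathcal{T})$ is the least cardinality of a base of $\mathcal{T}$. -/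

import Mathlib

open Filter Topology
open scoped Pointwise Cardinal

universe u

/-- The weight `w(X, T)`: the least cardinality of a base of the topology `T`.
The infimum is attained, since `T` itself is a base and cardinals are well-ordered. -/
noncomputable def topWeight {X : Type u} (T : TopologicalSpace X) : Cardinal.{u} :=
  sInf {κ : Cardinal.{u} |
    ∃ b : Set (Set X), @TopologicalSpace.IsTopologicalBasis X T b ∧ #b = κ}

/-- `T` is a (Hausdorff) totally bounded group topology on the additive group `G`: the group
operations are continuous, `T` is Hausdorff, and finitely many translates of each nonempty
open set cover `G`. -/
structure IsTotallyBoundedGroupTopology {G : Type u} [AddGroup G]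
    (T : TopologicalSpace G) : Prop where
  isTopologicalAddGroup : @IsTopologicalAddGroup G T _
  t2Space : @T2Space G T
  exists_finite_cover : ∀ U : Set G, IsOpen[T] U → U.Nonempty →
    ∃ F : Set G, F.Finite ∧ F + U = Set.univ

universe v

/-! Totally bounded group topologies come from groups of characters. A subgroup `A` of `G →+
UnitAddCircle` that separates points induces such a topology, and `A` is recovered as its group of
continuous characters (`mem_of_continuous_charTopology`). Hence distinct subgroups give distinct
topologies, and the weight is at least `#A` when `A` is uncountable.

It remains to find many subgroups of characters that are null along one sequence. In a countable
infinite group, a recursion makes points and characters small on each other so fast that every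
subseries of the characters converges and is null along the points. In general, such a sequence is
taken inside a countable subgroup `N`: characters of `N` extend to `G`, and characters of `G ⧸ N`
vanish on the sequence. So the null characters separate points and number at least `2 ^ #G`.

Modulo a small separating subgroup, they contain `2 ^ #G` independent elements, and choices among
these give `2 ^ 2 ^ #G` subgroups of size at least `2 ^ #G`. A homeomorphism class is controlled by
permutations of `G`, of which there are at most `2 ^ #G`, so one representative per class still
leaves `2 ^ 2 ^ #G` topologies. -/

/-! ### Cardinality of abelian groups and independent cyclic subgroups -/

theorem mk_le_of_fibers {X Y : Type u} {μ : Cardinal.{u}} (hμ : ℵ₀ ≤ μ) (f : X → Y)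
    (hY : #Y ≤ μ) (hf : ∀ y, #{x // f x = y} ≤ μ) : #X ≤ μ := by
  rw [← Cardinal.mk_congr (Equiv.sigmaFiberEquiv f), Cardinal.mk_sigma]
  calc Cardinal.sum (fun y => #{x // f x = y}) ≤ Cardinal.sum (fun _ : Y => μ) :=
        Cardinal.sum_le_sum _ _ hf
    _ = #Y * μ := by simp
    _ ≤ μ * μ := mul_le_mul_left hY _
    _ = μ := Cardinal.mul_eq_self hμ

theorem mk_span_int_le {Q : Type u} [AddCommGroup Q] (s : Set Q) :
    #(Submodule.span ℤ s) ≤ max ℵ₀ #s := by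
  have h : #(Submodule.span ℤ s) ≤ #(s →₀ ℤ) := by
    rw [← Subtype.range_coe (s := s), ← Finsupp.range_linearCombination]
    simp only [Subtype.range_coe]
    exact Cardinal.mk_le_of_surjective (LinearMap.surjective_rangeRestrict _)
  refine h.trans ?_
  rcases finite_or_infinite s with hs | hs
  · exact (Cardinal.mk_le_aleph0 (α := s →₀ ℤ)).trans (le_max_left _ _)
  · simp

theorem mk_closure_le {Q : Type u} [AddCommGroup Q] (s : Set Q) :
    #(AddSubgroup.closure s) ≤ max ℵ₀ #s := by
  rw [← Submodule.span_int_eq_addSubgroupClosure]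
  exact mk_span_int_le s

theorem mk_nsmul_fiber_le {Q : Type u} [AddCommGroup Q] (n : ℕ) (y : Q) :
    #{x : Q // n • x = y} ≤ #{x : Q // n • x = 0} := by
  rcases isEmpty_or_nonempty {x : Q // n • x = y} with h | ⟨⟨z, hz⟩⟩
  · simp
  · refine Cardinal.mk_le_of_injective
      (f := fun x => ⟨x.1 - z, by rw [nsmul_sub, x.2, hz, sub_self]⟩) fun a b hab => ?_
    simpa [Subtype.ext_iff] using hab

theorem mk_torsionBy_le_of_essential {Q : Type u} [AddCommGroup Q] (B : AddSubgroup Q)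
    (h : ∀ q ≠ 0, ∃ n : ℤ, n • q ≠ 0 ∧ n • q ∈ B) (n : ℕ) (hn : n ≠ 0) :
    #{x : Q // n • x = 0} ≤ max ℵ₀ #B := by
  have hμ : ℵ₀ ≤ max ℵ₀ #B := le_max_left _ _
  induction n using Nat.recOnMul with
  | zero => exact absurd rfl hn
  | one =>
    have : Subsingleton {x : Q // 1 • x = 0} :=
      ⟨fun a b => Subtype.ext (by simpa using a.2.trans b.2.symm)⟩
    exact (Cardinal.mk_le_aleph0).trans hμ
  | prime p hp =>
    refine le_trans (Cardinal.mk_le_of_injective (f := fun x => (⟨x.1, ?_⟩ : B))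
      fun a b hab => Subtype.ext (Subtype.mk.inj hab)) (le_max_right _ _)
    obtain ⟨x, hx⟩ := x
    by_cases hx0 : x = 0
    · subst hx0; exact B.zero_mem
    obtain ⟨m, hm0, hmB⟩ := h x hx0
    have hpx : (p : ℤ) • x = 0 := by simpa using hx
    have hc : IsCoprime m (p : ℤ) := by
      rw [isCoprime_comm, Prime.coprime_iff_not_dvd (Nat.prime_iff_prime_int.mp hp)]
      rintro ⟨k, rfl⟩
      exact hm0 (by rw [mul_comm, mul_smul, hpx, smul_zero])
    -- As `m` is invertible modulo the order `p` of `x`, the element `x` is itself a multiple of `m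
    -- • x`.
    obtain ⟨a, b, hab⟩ := hc
    have : x = a • (m • x) := by
      conv_lhs => rw [← one_smul ℤ x, ← hab, add_smul, mul_smul, mul_smul, hpx, smul_zero, add_zero]
    change x ∈ B
    rw [this]
    exact B.zsmul_mem hmB a
  | mul a b iha ihb =>
    rw [mul_ne_zero_iff] at hn
    refine mk_le_of_fibers hμ
      (fun x : {x : Q // (a * b) • x = 0} => (⟨b • x.1, by rw [← mul_smul]; exact x.2⟩ :
        {x : Q // a • x = 0})) (iha hn.1) fun y => ?_
    refine le_trans ?_ ((mk_nsmul_fiber_le b y.1).trans (ihb hn.2))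
    exact Cardinal.mk_le_of_injective
      (f := fun x => ⟨x.1.1, congrArg Subtype.val x.2⟩)
      fun x x' hx => Subtype.ext (Subtype.ext (Subtype.mk.inj hx))

/-- Send `q` to a positive `n` with `n • q ∈ B`, together with that multiple. Each fiber embeds in a
coset of the `n`-torsion, whose size is already bounded through `B`. -/
theorem mk_le_of_essential {Q : Type u} [AddCommGroup Q] (B : AddSubgroup Q)
    (h : ∀ q ≠ 0, ∃ n : ℤ, n • q ≠ 0 ∧ n • q ∈ B) : #Q ≤ max ℵ₀ #B := by
  have hμ : ℵ₀ ≤ max ℵ₀ #B := le_max_left _ _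
  have h' : ∀ q : Q, ∃ n : ℕ, n ≠ 0 ∧ n • q ∈ B := by
    intro q
    by_cases hq : q = 0
    · exact ⟨1, one_ne_zero, by simp [hq]⟩
    obtain ⟨n, hn0, hn⟩ := h q hq
    refine ⟨n.natAbs, fun h0 => hn0 (by simp [Int.natAbs_eq_zero.mp h0]), ?_⟩
    rw [← natCast_zsmul]
    rcases Int.natAbs_eq n with e | e
    · rwa [← e]
    · rwa [← neg_mem_iff, ← neg_smul, ← e]
  choose N hN0 hN using h'
  refine mk_le_of_fibers hμ (fun q => (⟨ULift.up (N q), ⟨N q • q, hN q⟩⟩ : ULift.{u} ℕ × B)) ?_ ?_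
  · rw [Cardinal.mk_prod]
    simp only [Cardinal.lift_id]
    refine (mul_le_mul' (Cardinal.mk_le_aleph0.trans hμ) (le_max_right ℵ₀ _)).trans ?_
    exact (Cardinal.mul_eq_self hμ).le
  · rintro ⟨⟨n⟩, b⟩
    by_cases hn : n = 0
    · have : IsEmpty {x : Q // ((⟨ULift.up (N x), ⟨N x • x, hN x⟩⟩ : ULift.{u} ℕ × B)) = ⟨⟨n⟩, b⟩} :=
        ⟨fun x => hN0 x.1 ((congrArg (fun z => z.1.down) x.2).trans hn)⟩
      exact (Cardinal.mk_eq_zero _).trans_le (Cardinal.aleph0_pos.le.trans hμ)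
    · refine le_trans ?_ ((mk_nsmul_fiber_le n b.1).trans (mk_torsionBy_le_of_essential B h n hn))
      refine Cardinal.mk_le_of_injective
        (f := fun x => ⟨x.1, ?_⟩) fun x x' hx => Subtype.ext (Subtype.mk.inj hx)
      have h1 : N x.1 = n := congrArg (fun z => z.1.down) x.2
      have h2 : N x.1 • x.1 = b.1 := congrArg (fun z => z.2.1) x.2
      rw [← h2, h1]

theorem exists_maximal_sSupIndep_cyclic (Q : Type u) [AddCommGroup Q] :
    ∃ S : Set (Submodule ℤ Q), sSupIndep S ∧ (∀ a ∈ S, ∃ x ≠ 0, a = Submodule.span ℤ {x}) ∧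
      ∀ x ≠ 0, ¬ Disjoint (Submodule.span ℤ {x}) (sSup S) := by
  have zorn := zorn_subset
    (S := {s : Set (Submodule ℤ Q) | sSupIndep s ∧ ∀ a ∈ s, ∃ x ≠ 0, a = Submodule.span ℤ {x}})
    fun c hc1 hc2 =>
      ⟨⋃₀ c, ⟨iSupIndep_sUnion_of_directed hc2.directedOn fun s hs => (hc1 hs).1,
          fun a ⟨s, sc, as⟩ => (hc1 sc).2 a as⟩,
        fun _ => Set.subset_sUnion_of_mem⟩
  simp_rw [maximal_subset_iff] at zorn
  obtain ⟨s, ⟨s_ind, s_cyc⟩, s_max⟩ := zorn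
  refine ⟨s, s_ind, s_cyc, fun y hy hdis => ?_⟩
  set a := Submodule.span ℤ {y} with ha
  have hane : a ≠ ⊥ := by simpa [ha] using hy
  have has : a ∉ s := fun has => hane (disjoint_self.mp (hdis.mono_right (le_sSup has)))
  refine has ?_
  rw [s_max ⟨fun x hx => ?_, fun x hx => ?_⟩ (Set.subset_union_left (t := {a}))]
  · exact Set.mem_union_right _ (Set.mem_singleton _)
  · rw [Set.mem_union, Set.mem_singleton_iff] at hx
    obtain rfl | xa := eq_or_ne x a
    · simp only [Set.mem_singleton, Set.insert_sdiff_of_mem, Set.union_singleton]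
      exact hdis.mono_right (sSup_le_sSup Set.sdiff_subset)
    · have h : (s ∪ {a}) \ {x} = s \ {x} ∪ {a} := by
        simp only [Set.union_singleton]
        rw [Set.insert_sdiff_of_notMem]
        rw [Set.mem_singleton_iff]
        exact Ne.symm xa
      rw [h, sSup_union, sSup_singleton]
      apply
        (s_ind (hx.resolve_right xa)).disjoint_sup_right_of_disjoint_sup_left
          (hdis.mono_right _).symm
      rw [← sSup_insert, Set.insert_sdiff_singleton, Set.insert_eq_of_mem (hx.resolve_right xa)]
  · rw [Set.mem_union, Set.mem_singleton_iff] at hx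
    obtain hx | rfl := hx
    · exact s_cyc x hx
    · exact ⟨y, hy, ha⟩

/-- A maximal independent family of cyclic subgroups has an essential sum, so the sum bounds `#Q`.
Each member contributes countably much, so uncountability forces the family to have `#Q` members. -/
theorem exists_iSupIndep_span_singleton (Q : Type u) [AddCommGroup Q] (hQ : ℵ₀ < #Q) :
    ∃ f : Q → Q, (∀ i, f i ≠ 0) ∧ iSupIndep fun i => Submodule.span ℤ {f i} := by
  obtain ⟨S, hS, hcyc, hmax⟩ := exists_maximal_sSupIndep_cyclic Q
  choose! g hg0 hg using hcyc
  have hspan : sSup S = Submodule.span ℤ (g '' S) := by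
    rw [Submodule.span_eq_iSup_of_singleton_spans, iSup_image, sSup_eq_iSup]
    exact iSup_congr fun a => iSup_congr fun ha => hg a ha
  have hle : #Q ≤ max ℵ₀ #S := by
    have h1 : #Q ≤ max ℵ₀ #(sSup S).toAddSubgroup := by
      refine mk_le_of_essential _ fun q hq => ?_
      have := hmax q hq
      rw [Submodule.disjoint_def] at this
      push Not at this
      obtain ⟨x, hx, hxS, hx0⟩ := this
      obtain ⟨n, rfl⟩ := Submodule.mem_span_singleton.mp hx
      exact ⟨n, hx0, hxS⟩
    have h2 : #(sSup S).toAddSubgroup ≤ max ℵ₀ #S := by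
      rw [hspan]
      exact (mk_span_int_le _).trans (max_le_max le_rfl Cardinal.mk_image_le)
    exact h1.trans (max_le (le_max_left _ _) h2)
  have hle' : #Q ≤ #S := by
    rcases le_max_iff.mp hle with h | h
    · exact absurd h hQ.not_ge
    · exact h
  obtain ⟨e⟩ := hle'
  refine ⟨fun i => g (e i), fun i => hg0 _ (e i).2, ?_⟩
  have : (fun i => Submodule.span ℤ {g (e i)}) = (fun a : S => a.1) ∘ e := by
    funext i; exact (hg _ (e i).2).symm
  rw [this]
  exact (sSupIndep_iff S).mp hS |>.comp e.injective

/-! ### Existence and number of circle-valued characters -/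

theorem exists_addMonoidHom_extension {A : Type u} {B : Type v} [AddCommGroup A] [AddCommGroup B]
    (f : A →+ B) (hf : Function.Injective f) (χ : A →+ UnitAddCircle) :
    ∃ ψ : B →+ UnitAddCircle, ψ.comp f = χ :=
  (Module.Baer.of_divisible _).extension_property_addMonoidHom f hf χ

theorem exists_addMonoidHom_unitAddCircle_ne_zero {A : Type u} [AddCommGroup A] {a : A}
    (ha : a ≠ 0) : ∃ χ : A →+ UnitAddCircle, χ a ≠ 0 := by
  obtain ⟨c, hc⟩ := CharacterModule.exists_character_apply_ne_zero_of_ne_zero ha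
  -- Inclusion of ℚ/ℤ into ℝ/ℤ, carrying a rational-valued character to a real one.
  let j : AddCircle (1 : ℚ) →+ UnitAddCircle :=
    QuotientAddGroup.map _ _ (Rat.castHom ℝ).toAddMonoidHom (by
      rw [AddSubgroup.zmultiples_le]
      exact ⟨1, by simp⟩)
  have hj : ∀ x, j x = 0 → x = 0 := by
    intro x
    induction x using QuotientAddGroup.induction_on with
    | H q =>
      intro h
      have h' : ((q : ℝ) : UnitAddCircle) = 0 := h
      rw [AddCircle.coe_eq_zero_iff] at h'
      obtain ⟨n, hn⟩ := h'
      refine (AddCircle.coe_eq_zero_iff (1 : ℚ)).mpr ⟨n, ?_⟩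
      simp only [zsmul_eq_mul, mul_one] at hn ⊢
      exact_mod_cast hn
  exact ⟨j.comp c, fun h => hc (hj _ h)⟩

/-- On independent cyclic subgroups characters can be prescribed freely, either nonzero or zero on
each generator. Divisibility of the circle extends every choice to `Q`. -/
theorem two_power_mk_le_mk_addMonoidHom (Q : Type u) [AddCommGroup Q] (hQ : ℵ₀ < #Q) :
    (2 : Cardinal.{u}) ^ #Q ≤ #(Q →+ UnitAddCircle) := by
  classical
  obtain ⟨f, hf0, hf⟩ := exists_iSupIndep_span_singleton Q hQ
  have hc : ∀ i, ∃ χ : Submodule.span ℤ {f i} →+ UnitAddCircle,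
      χ ⟨f i, Submodule.mem_span_singleton_self _⟩ ≠ 0 := fun i =>
    exists_addMonoidHom_unitAddCircle_ne_zero (by simpa [Subtype.ext_iff] using hf0 i)
  choose c hc using hc
  have key : ∀ s : Set Q, ∃ ψ : Q →+ UnitAddCircle, ∀ i, ψ (f i) ≠ 0 ↔ i ∈ s := by
    intro s
    let L : (Π₀ i, Submodule.span ℤ {f i}) →+ Q :=
      (DFinsupp.lsum ℕ fun i => (Submodule.span ℤ {f i}).subtype).toAddMonoidHom
    obtain ⟨ψ, hψ⟩ := exists_addMonoidHom_extension L hf.dfinsupp_lsum_injective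
      (DFinsupp.sumAddHom fun i => if i ∈ s then c i else 0)
    refine ⟨ψ, fun i => ?_⟩
    have h1 := DFunLike.congr_fun hψ
      (DFinsupp.single i ⟨f i, Submodule.mem_span_singleton_self _⟩)
    have h2 : L (DFinsupp.single i ⟨f i, Submodule.mem_span_singleton_self _⟩) = f i := by
      simp [L]
    rw [AddMonoidHom.comp_apply, h2, DFinsupp.sumAddHom_single] at h1
    rw [h1]
    by_cases hi : i ∈ s <;> simp [hi, hc i]
  choose ψ hψ using key
  rw [← Cardinal.mk_set]
  refine Cardinal.mk_le_of_injective (f := ψ) fun s t h => ?_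
  ext i
  rw [← hψ, ← hψ, h]

/-! ### Characters of compact groups: Stone–Weierstrass and orthogonality -/

open MeasureTheory in
theorem integral_toCircle_eq_zero {K : Type*} [AddGroup K] [MeasurableSpace K] [MeasurableAdd K]
    (μ : Measure K) [μ.IsAddLeftInvariant] (ρ : K →+ UnitAddCircle) (hρ : ρ ≠ 0) :
    ∫ k, (AddCircle.toCircle (ρ k) : ℂ) ∂μ = 0 := by
  obtain ⟨k₀, hk₀⟩ := DFunLike.ne_iff.mp hρ
  have h := integral_add_left_eq_self (μ := μ) (fun k => (AddCircle.toCircle (ρ k) : ℂ)) k₀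
  simp only [map_add, AddCircle.toCircle_add, Circle.coe_mul, integral_const_mul] at h
  by_contra hne
  have h1 : (AddCircle.toCircle (ρ k₀) : ℂ) = 1 := mul_right_cancel₀ hne (by rw [h, one_mul])
  refine hk₀ (AddCircle.injective_toCircle one_ne_zero ?_)
  rw [AddMonoidHom.zero_apply, AddCircle.toCircle_zero]
  exact Circle.coe_injective h1

theorem span_range_topologicalClosure_eq_top {X : Type*} [TopologicalSpace X] [CompactSpace X]
    {A : Type*} [AddGroup A] (e : A → C(X, ℂ)) (h0 : e 0 = 1)
    (hadd : ∀ a b, e (a + b) = e a * e b) (hneg : ∀ a, e (-a) = star (e a))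
    (hsep : ∀ x y, (∀ a, e a x = e a y) → x = y) :
    (Submodule.span ℂ (Set.range e)).topologicalClosure = ⊤ := by
  let S : StarSubalgebra ℂ C(X, ℂ) :=
    { toSubalgebra := Algebra.adjoin ℂ (Set.range e)
      star_mem' := by
        change Algebra.adjoin ℂ (Set.range e) ≤ star (Algebra.adjoin ℂ (Set.range e))
        refine Algebra.adjoin_le ?_
        rintro - ⟨n, rfl⟩
        exact Algebra.subset_adjoin ⟨-n, hneg n⟩ }
  have hS : Subalgebra.toSubmodule S.toSubalgebra = Submodule.span ℂ (Set.range e) := by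
    apply Algebra.adjoin_eq_span_of_subset
    refine Set.Subset.trans ?_ Submodule.subset_span
    intro x hx
    refine Submonoid.closure_induction (fun _ => id) ⟨0, h0⟩ ?_ hx
    rintro - - - - ⟨m, rfl⟩ ⟨n, rfl⟩
    exact ⟨m + n, hadd m n⟩
  have hsepS : S.SeparatesPoints := by
    intro x y hxy
    have : ∃ a, e a x ≠ e a y := by
      contrapose! hxy
      exact hsep x y hxy
    obtain ⟨a, ha⟩ := this
    exact ⟨_, ⟨e a, Algebra.subset_adjoin ⟨a, rfl⟩, rfl⟩, ha⟩
  rw [← hS]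
  exact congr_arg (Subalgebra.toSubmodule <| StarSubalgebra.toSubalgebra ·)
    (ContinuousMap.starSubalgebra_topologicalClosure_eq_top_of_separatesPoints S hsepS)

/-- A character of a compact group lies in any group of characters that separates points. -/
theorem exists_eq_of_separating_characters {K : Type*} [AddCommGroup K] [TopologicalSpace K]
    [IsTopologicalAddGroup K] [CompactSpace K] {A : Type*} [AddCommGroup A]
    (e : A →+ K →+ UnitAddCircle) (he : ∀ a, Continuous (e a))
    (hsep : ∀ x y, (∀ a, e a x = e a y) → x = y) (χ : K →+ UnitAddCircle) (hχ : Continuous χ) :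
    ∃ a, e a = χ := by
  classical
  by_contra! hne
  borelize K
  let μ : MeasureTheory.Measure K := MeasureTheory.Measure.addHaar
  let E : (K →+ UnitAddCircle) → (K → ℂ) := fun ρ k => (AddCircle.toCircle (ρ k) : ℂ)
  have hE : ∀ {ρ : K →+ UnitAddCircle}, Continuous ρ → Continuous (E ρ) := fun h =>
    continuous_subtype_val.comp (AddCircle.continuous_toCircle.comp h)
  let c : A → C(K, ℂ) := fun a => ⟨E (e a), hE (he a)⟩
  let X : C(K, ℂ) := ⟨E χ, hE hχ⟩
  have hmul : ∀ ρ σ k, E ρ k * star (E σ k) = E (ρ - σ) k := by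
    intro ρ σ k
    simp only [E]
    rw [AddMonoidHom.sub_apply, sub_eq_add_neg, AddCircle.toCircle_add,
      AddCircle.toCircle_neg, Circle.coe_mul, Circle.coe_inv_eq_conj]
    rfl
  have hnorm : ∀ ρ k, ‖E ρ k‖ = 1 := fun ρ k => Circle.norm_coe _
  have htop := span_range_topologicalClosure_eq_top c
    (by ext k; simp [c, E])
    (by intro a b; ext k; simp [c, E, AddCircle.toCircle_add])
    (by
      intro a
      ext k
      simp only [c, E, ContinuousMap.coe_mk, ContinuousMap.star_apply, map_neg,
        AddMonoidHom.neg_apply]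
      rw [AddCircle.toCircle_neg, Circle.coe_inv_eq_conj]
      rfl)
    (by
      intro x y h
      refine hsep x y fun a => AddCircle.injective_toCircle one_ne_zero ?_
      have := h a
      simp only [c, E, ContinuousMap.coe_mk] at this
      exact Circle.coe_injective this)
  have hX : X ∈ closure (Submodule.span ℂ (Set.range c) : Set C(K, ℂ)) := by
    rw [← Submodule.topologicalClosure_coe, htop]; trivial
  -- If `χ` is not among the `e a`, it is orthogonal to their span. Since `X` has modulus 1, an
  -- approximant within distance less than 1 would then give `μ(K) ≤ dist X p * μ(K) < μ(K)`.
  obtain ⟨p, hp, hpX⟩ := Metric.mem_closure_iff.mp hX 1 one_pos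
  have hint : ∀ f : C(K, ℂ), MeasureTheory.Integrable (fun k => f k * star (X k)) μ := fun f =>
    (f * star X).continuous.integrable_of_hasCompactSupport
      (HasCompactSupport.of_compactSpace _)
  have hzero : ∫ k, p k * star (X k) ∂μ = 0 := by
    clear hpX
    induction hp using Submodule.span_induction with
    | mem f hf =>
      obtain ⟨a, rfl⟩ := hf
      have h : ∀ k, c a k * star (X k) = E (e a - χ) k := fun k => hmul _ _ _
      simp_rw [h]
      exact integral_toCircle_eq_zero μ _ (sub_ne_zero.mpr (hne a))
    | zero => simp
    | add f g _ _ hf hg =>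
      simp only [ContinuousMap.add_apply, add_mul]
      rw [MeasureTheory.integral_add (hint f) (hint g), hf, hg, add_zero]
    | smul r f _ hf =>
      simp only [ContinuousMap.smul_apply, smul_eq_mul, mul_assoc]
      rw [MeasureTheory.integral_const_mul, hf, mul_zero]
  have hone : ∀ k, X k * star (X k) = 1 := fun k => by
    rw [show X k = E χ k from rfl, hmul, sub_self]
    simp [E]
  have hX1 : ∫ k, (X - p) k * star (X k) ∂μ = μ.real Set.univ := by
    simp only [ContinuousMap.sub_apply, sub_mul]
    rw [MeasureTheory.integral_sub (hint X) (hint p), hzero, sub_zero]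
    simp_rw [hone]
    simp
  have hle := MeasureTheory.norm_integral_le_of_norm_le_const (μ := μ) (C := dist X p)
    (f := fun k => (X - p) k * star (X k)) (Eventually.of_forall fun k => by
      rw [norm_mul, norm_star, show ‖X k‖ = 1 from hnorm χ k, mul_one, dist_eq_norm]
      exact (X - p).norm_coe_le_norm k)
  rw [hX1, Complex.norm_real, Real.norm_of_nonneg MeasureTheory.measureReal_nonneg] at hle
  have hpos : 0 < μ.real Set.univ := MeasureTheory.measureReal_univ_pos
  nlinarith

/-! ### Topologies induced by groups of characters -/

/-- The coarsest topology on `G` for which every `χ ∈ A` is continuous. -/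
abbrev charTopology {G : Type u} [AddCommGroup G] (A : AddSubgroup (G →+ UnitAddCircle)) :
    TopologicalSpace G :=
  TopologicalSpace.induced (fun g (χ : A) => χ.1 g) inferInstance

/-- The joint evaluation of all characters in `A`. -/
def evalPi {G : Type u} [AddCommGroup G] (A : AddSubgroup (G →+ UnitAddCircle)) :
    G →+ (A → UnitAddCircle) :=
  AddMonoidHom.pi fun χ => χ.1

theorem continuous_charTopology {G : Type u} [AddCommGroup G]
    {A : AddSubgroup (G →+ UnitAddCircle)} {χ : G →+ UnitAddCircle} (hχ : χ ∈ A) :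
    @Continuous G UnitAddCircle (charTopology A) _ χ := by
  let := charTopology A
  have h : Continuous (evalPi A) := continuous_induced_dom
  exact (continuous_apply (⟨χ, hχ⟩ : A)).comp h

theorem isTopologicalAddGroup_charTopology {G : Type u} [AddCommGroup G]
    (A : AddSubgroup (G →+ UnitAddCircle)) : @IsTopologicalAddGroup G (charTopology A) _ :=
  topologicalAddGroup_induced (evalPi A)

theorem exists_pos_forall_mem_finset_le {ι : Type*} (s : Finset ι) (δ : ι → ℝ)
    (hδ : ∀ i ∈ s, 0 < δ i) : ∃ ε > 0, ∀ i ∈ s, ε ≤ δ i := by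
  have := (s.eventually_all (l := 𝓝[>] (0 : ℝ)) (p := fun i ε => ε ≤ δ i)).mpr
    fun i hi => mem_nhdsWithin_of_mem_nhds (eventually_le_nhds (hδ i hi))
  obtain ⟨ε, h1, h2⟩ := (this.and self_mem_nhdsWithin).exists
  exact ⟨ε, h2, h1⟩

theorem mem_nhds_zero_charTopology_iff {G : Type u} [AddCommGroup G]
    {A : AddSubgroup (G →+ UnitAddCircle)} {U : Set G} :
    U ∈ @nhds G (charTopology A) 0 ↔ ∃ F : Finset (G →+ UnitAddCircle), (∀ χ ∈ F, χ ∈ A) ∧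
      ∃ ε > 0, {g | ∀ χ ∈ F, ‖χ g‖ < ε} ⊆ U := by
  classical
  constructor
  · intro hU
    rw [charTopology, nhds_induced, nhds_pi, mem_comap] at hU
    obtain ⟨V, hV, hVU⟩ := hU
    obtain ⟨I, hI, t, ht, htV⟩ := Filter.mem_pi.mp hV
    have ht' : ∀ i : A, ∃ ε > 0, ∀ y : UnitAddCircle, ‖y‖ < ε → y ∈ t i := by
      intro i
      have h := ht i
      simp only [map_zero] at h
      obtain ⟨ε, hε, h⟩ := Metric.mem_nhds_iff.mp h
      exact ⟨ε, hε, fun y hy => h (by simpa using hy)⟩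
    choose δ hδ hδt using ht'
    obtain ⟨ε, hε, hεδ⟩ := exists_pos_forall_mem_finset_le hI.toFinset δ fun i _ => hδ i
    refine ⟨hI.toFinset.image Subtype.val, ?_, ε, hε, ?_⟩
    · intro χ hχ
      rw [Finset.mem_image] at hχ
      obtain ⟨a, -, rfl⟩ := hχ
      exact a.2
    · intro g hg
      refine hVU (htV fun i hi => hδt i _ ((hg i.1 ?_).trans_le (hεδ i (hI.mem_toFinset.mpr hi))))
      exact Finset.mem_image_of_mem _ (hI.mem_toFinset.mpr hi)
  · rintro ⟨F, hF, ε, hε, hU⟩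
    let := charTopology A
    refine mem_of_superset ?_ hU
    refine (F.eventually_all (l := 𝓝 (0 : G))).mpr fun χ hχ => ?_
    have hc : Continuous fun g => ‖χ g‖ := (continuous_charTopology (hF χ hχ)).norm
    exact hc.tendsto' 0 0 (by simp) |>.eventually (gt_mem_nhds hε)

theorem exists_finite_add_eq_univ {X K : Type*} [AddCommGroup X] [AddCommGroup K]
    [TopologicalSpace K] [IsTopologicalAddGroup K] [CompactSpace K] (f : X →+ K) {V : Set K}
    (hV : IsOpen V) (hne : (f ⁻¹' V).Nonempty) :
    ∃ F : Set X, F.Finite ∧ F + f ⁻¹' V = Set.univ := by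
  obtain ⟨x₀, hx₀⟩ := hne
  have hc : Continuous fun p : K × K => f x₀ + (p.1 - p.2) := by fun_prop
  have hW : (fun p : K × K => f x₀ + (p.1 - p.2)) ⁻¹' V ∈ 𝓝 ((0, 0) : K × K) :=
    (hV.preimage hc).mem_nhds (by simpa using hx₀)
  rw [nhds_prod_eq, mem_prod_same_iff] at hW
  obtain ⟨N, hN, hNV⟩ := hW
  obtain ⟨t, -, ht⟩ := isCompact_univ.elim_nhds_subcover (fun k : K => {y | y - k ∈ N}) fun k _ => by
    have : Continuous fun y : K => y - k := by fun_prop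
    exact this.tendsto' k 0 (by simp) hN
  choose! g hg using fun (k : K) (h : ∃ x, f x - k ∈ N) => h
  refine ⟨(fun k => g k - x₀) '' t, t.finite_toSet.image _, Set.eq_univ_of_forall fun x => ?_⟩
  obtain ⟨k, hk, hxk⟩ := Set.mem_iUnion₂.mp (ht (Set.mem_univ (f x)))
  refine Set.mem_add.mpr ⟨g k - x₀, ⟨k, hk, rfl⟩, x - g k + x₀, ?_, by abel⟩
  have := hNV (Set.mk_mem_prod hxk (hg k ⟨x, hxk⟩))
  simp only [Set.mem_preimage] at this ⊢
  convert this using 1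
  simp only [map_add, map_sub]
  abel

theorem isTotallyBoundedGroupTopology_charTopology {G : Type u} [AddCommGroup G]
    (A : AddSubgroup (G →+ UnitAddCircle)) (hA : ∀ g ≠ 0, ∃ χ ∈ A, χ g ≠ 0) :
    IsTotallyBoundedGroupTopology (charTopology A) where
  isTopologicalAddGroup := isTopologicalAddGroup_charTopology A
  t2Space := by
    let := charTopology A
    refine T2Space.of_injective_continuous (f := evalPi A) ?_ continuous_induced_dom
    refine (injective_iff_map_eq_zero _).mpr fun g hg => ?_
    by_contra hne
    obtain ⟨χ, hχ, h⟩ := hA g hne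
    exact h (congrFun hg ⟨χ, hχ⟩)
  exists_finite_cover := by
    rintro U ⟨V, hV, rfl⟩ hne
    exact exists_finite_add_eq_univ (evalPi A) hV hne

/-- Let `K` be the closure of the image of `G` under `evalPi A` paired with `χ`. Continuity of `χ`
makes the last coordinate vanish wherever the others do, so the `A`-coordinates separate points of
the compact group `K`. The last coordinate must then be one of them. -/
theorem mem_of_continuous_charTopology {G : Type u} [AddCommGroup G]
    {A : AddSubgroup (G →+ UnitAddCircle)} {χ : G →+ UnitAddCircle}
    (hχ : @Continuous G UnitAddCircle (charTopology A) _ χ) : χ ∈ A := by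
  let D := ((evalPi A).prod χ).range
  let K := D.topologicalClosure
  have hK : IsClosed (K : Set ((A → UnitAddCircle) × UnitAddCircle)) :=
    D.isClosed_topologicalClosure
  have : CompactSpace K := isCompact_iff_compactSpace.mp hK.isCompact
  have hker : ∀ z : (A → UnitAddCircle) × UnitAddCircle, z ∈ K → z.1 = 0 → z.2 = 0 := by
    intro z hz hz1
    by_contra hz2
    have hpos : 0 < ‖z.2‖ / 2 := by positivity
    let := charTopology A
    have hU : {g : G | ‖χ g‖ < ‖z.2‖ / 2} ∈ 𝓝 (0 : G) :=
      hχ.norm.tendsto' 0 0 (by simp) |>.eventually (gt_mem_nhds hpos)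
    obtain ⟨V, hV, hVU⟩ := mem_comap.mp ((nhds_induced (evalPi A) (0 : G)) ▸ hU)
    rw [map_zero, ← hz1] at hV
    have hW : V ×ˢ {y | ‖y - z.2‖ < ‖z.2‖ / 2} ∈ 𝓝 z := by
      rw [← Prod.mk.eta (p := z), nhds_prod_eq]
      refine prod_mem_prod hV ?_
      have hc : Continuous fun y => ‖y - z.2‖ := by fun_prop
      exact hc.tendsto' z.2 0 (by simp) |>.eventually (gt_mem_nhds hpos)
    obtain ⟨w, hw, ⟨g, rfl⟩⟩ := mem_closure_iff_nhds.mp hz _ hW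
    have h1 : ‖χ g‖ < ‖z.2‖ / 2 := hVU hw.1
    have h2 : ‖χ g - z.2‖ < ‖z.2‖ / 2 := hw.2
    have h3 : ‖z.2‖ ≤ ‖χ g‖ + ‖χ g - z.2‖ := by
      have := norm_sub_le (χ g) (χ g - z.2)
      simpa using this
    linarith
  let e : A →+ K →+ UnitAddCircle := AddMonoidHom.mk'
    (fun a => ((Pi.evalAddMonoidHom (fun _ : A => UnitAddCircle) a).comp
      (AddMonoidHom.fst _ _)).comp K.subtype) (by
      intro a b
      ext ⟨z, hz⟩
      change z.1 (a + b) = z.1 a + z.1 b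
      -- Additivity in the index is a closed condition that holds on `D`, hence on its closure `K`.
      have hcl : IsClosed {z : (A → UnitAddCircle) × UnitAddCircle | z.1 (a + b) = z.1 a + z.1 b} :=
        isClosed_eq (by fun_prop) (by fun_prop)
      refine closure_minimal (s := (D : Set ((A → UnitAddCircle) × UnitAddCircle))) ?_ hcl hz
      rintro _ ⟨g, rfl⟩
      rfl)
  obtain ⟨a, ha⟩ := exists_eq_of_separating_characters e
    (fun a => by
      change Continuous fun z : K => z.1.1 a
      fun_prop)
    (by
      intro x y h
      have h1 : (x - y : K).1.1 = 0 := by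
        funext a
        exact sub_eq_zero.mpr (h a)
      have h2 := hker _ (x - y).2 h1
      rw [← sub_eq_zero]
      exact Subtype.ext (Prod.ext h1 h2))
    ((AddMonoidHom.snd _ _).comp K.subtype) (by
      change Continuous fun z : K => z.1.2
      fun_prop)
  have : χ = a.1 := by
    ext g
    have hg : ((evalPi A).prod χ) g ∈ K := D.le_topologicalClosure ⟨g, rfl⟩
    exact (DFunLike.congr_fun ha ⟨_, hg⟩).symm
  rw [this]
  exact a.2

theorem mem_of_forall_mem_nhds_charTopology {G : Type u} [AddCommGroup G]
    {A : AddSubgroup (G →+ UnitAddCircle)} {χ : G →+ UnitAddCircle}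
    (h : ∀ V ∈ 𝓝 (0 : UnitAddCircle), χ ⁻¹' V ∈ @nhds G (charTopology A) 0) : χ ∈ A := by
  apply mem_of_continuous_charTopology
  let _ := charTopology A
  have := isTopologicalAddGroup_charTopology A
  refine continuous_of_continuousAt_zero χ ?_
  rw [ContinuousAt, map_zero]
  exact h

theorem charTopology_injective {G : Type u} [AddCommGroup G] :
    Function.Injective (charTopology (G := G)) := by
  intro A B h
  ext χ
  exact ⟨fun hχ => mem_of_continuous_charTopology (h ▸ continuous_charTopology hχ),
    fun hχ => mem_of_continuous_charTopology (h ▸ continuous_charTopology hχ)⟩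

/-- Each basic neighborhood of 0 is witnessed by finitely many characters. Those collected from a
base generate a topology making all of `A` continuous, so by duality they generate `A`. -/
theorem mk_le_topWeight_charTopology {G : Type u} [AddCommGroup G]
    (A : AddSubgroup (G →+ UnitAddCircle)) (hA : ℵ₀ < #A) :
    #A ≤ topWeight (charTopology A) := by
  refine le_csInf ⟨_, _, @TopologicalSpace.isTopologicalBasis_opens G (charTopology A), rfl⟩ ?_
  rintro κ ⟨b, hb, rfl⟩
  let := charTopology A
  have hF : ∀ U : {U : Set G // U ∈ b ∧ (0 : G) ∈ U}, ∃ F : Finset (G →+ UnitAddCircle),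
      (∀ χ ∈ F, χ ∈ A) ∧ ∃ ε > 0, {g | ∀ χ ∈ F, ‖χ g‖ < ε} ⊆ U.1 := fun U =>
    mem_nhds_zero_charTopology_iff.mp (hb.mem_nhds U.2.1 U.2.2)
  choose F hFA ε hε hFU using hF
  let S : Set (G →+ UnitAddCircle) := ⋃ U, {χ | χ ∈ F U}
  have hle : A ≤ AddSubgroup.closure S := by
    intro χ hχ
    refine mem_of_forall_mem_nhds_charTopology fun V hV => ?_
    have h1 : χ ⁻¹' V ∈ @nhds G (charTopology A) 0 :=
      (continuous_charTopology hχ).tendsto' 0 0 (by simp) hV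
    obtain ⟨U, hU, h0U, hUV⟩ := hb.mem_nhds_iff.mp h1
    refine mem_of_superset (mem_nhds_zero_charTopology_iff.mpr
      ⟨F ⟨U, hU, h0U⟩, ?_, ε ⟨U, hU, h0U⟩, hε _, hFU _⟩) hUV
    exact fun ψ hψ => AddSubgroup.subset_closure (Set.mem_iUnion.mpr ⟨_, hψ⟩)
  have hS : #S ≤ max ℵ₀ #b := by
    refine (Cardinal.mk_iUnion_le _).trans ?_
    refine (mul_le_mul' (Cardinal.mk_le_of_injective (f := fun U => (⟨U.1, U.2.1⟩ : b))
      fun U V h => Subtype.ext (Subtype.mk.inj h)) (ciSup_le' fun U => ?_)).trans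
      (Cardinal.mul_le_max_of_aleph0_le_right le_rfl |>.trans (max_comm _ _).le)
    exact (F U).finite_toSet.countable.le_aleph0
  have h : #A ≤ max ℵ₀ #b :=
    (Cardinal.mk_le_mk_of_subset hle).trans ((mk_closure_le S).trans (max_le (le_max_left _ _) hS))
  exact (le_max_iff.mp h).resolve_left hA.not_ge

theorem topWeight_le {X : Type u} (T : TopologicalSpace X) : topWeight T ≤ 2 ^ #X := by
  rw [← Cardinal.mk_set]
  refine (csInf_le' ?_).trans (Cardinal.mk_set_le {U : Set X | IsOpen[T] U})
  exact ⟨_, @TopologicalSpace.isTopologicalBasis_opens X T, rfl⟩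

/-! ### Null sequences and characters on countable groups -/

theorem infinite_setOf_forall_norm_lt {X : Type*} [AddCommGroup X] [Infinite X]
    (Φ : Finset (X →+ UnitAddCircle)) {ε : ℝ} (hε : 0 < ε) :
    {x : X | ∀ φ ∈ Φ, ‖φ x‖ < ε}.Infinite := by
  let f : X →+ (Φ → UnitAddCircle) := AddMonoidHom.pi fun φ => φ.1
  have hV : IsOpen {k : Φ → UnitAddCircle | ∀ φ, ‖k φ‖ < ε} := by
    simp only [Set.ofPred_forall]
    exact isOpen_iInter_of_finite fun φ => isOpen_lt (by fun_prop) continuous_const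
  obtain ⟨F, hF, hcover⟩ := exists_finite_add_eq_univ f hV ⟨0, fun φ => by simpa using hε⟩
  have heq : f ⁻¹' {k : Φ → UnitAddCircle | ∀ φ, ‖k φ‖ < ε} = {x : X | ∀ φ ∈ Φ, ‖φ x‖ < ε} := by
    ext x
    exact ⟨fun h φ hφ => h ⟨φ, hφ⟩, fun h φ => h φ.1 φ.2⟩
  rw [heq] at hcover
  intro hfin
  exact Set.infinite_univ (hcover ▸ hF.add hfin)

/-- A finite character group of order `m` takes values in the finite `m`-torsion of the circle.
Separation of points would then embed `X` in a finite product of finite sets. -/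
theorem infinite_addMonoidHom_unitAddCircle (X : Type*) [AddCommGroup X] [Infinite X] :
    Infinite (X →+ UnitAddCircle) := by
  by_contra hinf
  have : Finite (X →+ UnitAddCircle) := not_infinite_iff_finite.mp hinf
  set m := Nat.card (X →+ UnitAddCircle) with hm
  have hm0 : m ≠ 0 := Nat.card_pos.ne'
  have hfin : Finite {t : UnitAddCircle | m • t = 0} :=
    AddCircle.finite_torsion (1 : ℝ) (Nat.pos_of_ne_zero hm0)
  have htors : ∀ (χ : X →+ UnitAddCircle) x, m • χ x = 0 := fun χ x =>
    DFunLike.congr_fun (card_nsmul_eq_zero' : m • χ = 0) x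
  let F : X → ((X →+ UnitAddCircle) → {t : UnitAddCircle | m • t = 0}) :=
    fun x χ => ⟨χ x, htors χ x⟩
  have hF : Function.Injective F := by
    intro x y hxy
    by_contra hne
    obtain ⟨χ, hχ⟩ := exists_addMonoidHom_unitAddCircle_ne_zero (sub_ne_zero.mpr hne)
    refine hχ ?_
    rw [map_sub, sub_eq_zero]
    exact congrArg Subtype.val (congrFun hxy χ)
  exact not_finite_iff_infinite.mpr ‹_› (Finite.of_injective F hF)

theorem tsum_norm_lt_of_quarter_pow {E : Type*} [SeminormedAddCommGroup E] {d : ℕ → E} {M : ℝ}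
    (hM : 0 < M) (hd : ∀ m, ‖d m‖ ≤ (1 / 4) ^ (m + 1) * M) : ‖∑' m, d m‖ < M := by
  have hs : HasSum (fun m : ℕ => (1 / 4 : ℝ) ^ (m + 1) * M) (1 / 3 * M) := by
    have := ((hasSum_geometric_of_lt_one (r := (1 / 4 : ℝ)) (by norm_num) (by norm_num)).mul_left
      (1 / 4)).mul_right M
    have e : (fun m : ℕ => (1 / 4 : ℝ) ^ (m + 1) * M) = fun i => 1 / 4 * (1 / 4) ^ i * M := by
      funext m; ring
    rw [e]
    convert! this using 1
    norm_num
  have := tsum_of_norm_bounded hs hd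
  linarith

theorem exists_small_element_and_character {N : Type*} [AddCommGroup N] [Infinite N]
    (E Y : Finset N) (Φ : Finset (N →+ UnitAddCircle)) {ε δ : ℝ} (hε : 0 < ε) (hδ : 0 < δ) :
    ∃ (x : N) (a : N →+ UnitAddCircle) (w : N), x ∉ E ∧ (∀ φ ∈ Φ, ‖φ x‖ < ε) ∧ a w ≠ 0 ∧
      ‖a x‖ < δ ∧ ∀ y ∈ Y, ‖a y‖ < δ := by
  classical
  have := infinite_addMonoidHom_unitAddCircle N
  obtain ⟨x, hx, hxE⟩ := (infinite_setOf_forall_norm_lt Φ hε).exists_notMem_finset E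
  let ev : N → (N →+ UnitAddCircle) →+ UnitAddCircle := fun y =>
    { toFun := fun a => a y, map_zero' := rfl, map_add' := fun _ _ => rfl }
  -- The same smallness lemma is applied to the dual group, with evaluations as its characters.
  obtain ⟨a, ha, ha0⟩ := (infinite_setOf_forall_norm_lt
    ((insert x Y).image ev) hδ).exists_notMem_finset {0}
  obtain ⟨w, hw⟩ := DFunLike.ne_iff.mp (Finset.notMem_singleton.mp ha0)
  have ha' : ∀ y ∈ insert x Y, ‖a y‖ < δ := fun y hy => ha (ev y) (Finset.mem_image_of_mem ev hy)
  exact ⟨x, a, w, hxE, hx, hw, ha' x (Finset.mem_insert_self _ _),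
    fun y hy => ha' y (Finset.mem_insert_of_mem hy)⟩

/-- A rapidly convergent sequence of pairs of a group element and a nonzero character. -/
theorem exists_rapid_sequence {N : Type*} [AddCommGroup N] [Infinite N] (g : ℕ → N)
    (c : ℕ → N →+ UnitAddCircle) :
    ∃ (n : ℕ → ℕ) (x : ℕ → N) (a : ℕ → N →+ UnitAddCircle) (w : ℕ → N), StrictMono n ∧
      Function.Injective x ∧ (∀ k, a k (w k) ≠ 0) ∧
      (∀ k, ∀ j ≤ n k, ‖c j (x k)‖ ≤ (1 / 4) ^ n k) ∧
      (∀ k, ∀ j ≤ n k, ‖a k (g j)‖ ≤ (1 / 4) ^ n k) ∧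
      (∀ k j, ‖a k (x j)‖ ≤ (1 / 4) ^ n (max k j)) ∧
      (∀ k j, k < j → ‖a j (w k)‖ ≤ (1 / 4) ^ n j * ‖a k (w k)‖) := by
  classical
  obtain ⟨f, hP, hR⟩ := exists_seq_of_forall_finset_exists
    (α := ℕ × N × (N →+ UnitAddCircle) × N)
    (fun t => t.2.2.1 t.2.2.2 ≠ 0 ∧ (∀ j ≤ t.1, ‖c j t.2.1‖ ≤ (1 / 4) ^ t.1) ∧
      (∀ j ≤ t.1, ‖t.2.2.1 (g j)‖ ≤ (1 / 4) ^ t.1) ∧ ‖t.2.2.1 t.2.1‖ ≤ (1 / 4) ^ t.1)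
    (fun t t' => t.1 < t'.1 ∧ t.2.1 ≠ t'.2.1 ∧ ‖t.2.2.1 t'.2.1‖ ≤ (1 / 4) ^ t'.1 ∧
      ‖t'.2.2.1 t.2.1‖ ≤ (1 / 4) ^ t'.1 ∧
      ‖t'.2.2.1 t.2.2.2‖ ≤ (1 / 4) ^ t'.1 * ‖t.2.2.1 t.2.2.2‖) (by
    intro s hs
    let n := s.sup Prod.fst + 1
    have hn : (0 : ℝ) < (1 / 4) ^ n := by positivity
    -- The new character must be small relative to the old values `a k (w k)`, so that later terms
    -- cannot cancel them.
    obtain ⟨ε, hε, hεs⟩ := exists_pos_forall_mem_finset_le s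
      (fun t => (1 / 4) ^ n * ‖t.2.2.1 t.2.2.2‖)
      fun t ht => mul_pos hn (norm_pos_iff.mpr (hs t ht).1)
    obtain ⟨x, a, w, hxs, hx, hw, hax, ha⟩ := exists_small_element_and_character
      (s.image fun t => t.2.1)
      ((Finset.range (n + 1)).image g ∪ s.image (fun t => t.2.1) ∪ s.image (fun t => t.2.2.2))
      ((Finset.range (n + 1)).image c ∪ s.image fun t => t.2.2.1) hn (lt_min hε hn)
    simp only [Finset.mem_union, Finset.mem_image, Finset.mem_range, Nat.lt_succ_iff] at hxs hx ha
    refine ⟨⟨n, x, a, w⟩, ⟨hw, fun j hj => (hx _ (Or.inl ⟨j, hj, rfl⟩)).le, fun j hj =>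
      (ha _ (Or.inl (Or.inl ⟨j, hj, rfl⟩))).le.trans (min_le_right _ _),
      hax.le.trans (min_le_right _ _)⟩, fun t ht =>
      ⟨Nat.lt_succ_of_le (Finset.le_sup (f := Prod.fst) ht), fun h => hxs ⟨t, ht, h⟩,
        (hx _ (Or.inr ⟨t, ht, rfl⟩)).le,
        (ha _ (Or.inl (Or.inr ⟨t, ht, rfl⟩))).le.trans (min_le_right _ _),
        (ha _ (Or.inr ⟨t, ht, rfl⟩)).le.trans ((min_le_left _ _).trans (hεs t ht))⟩⟩)
  refine ⟨fun k => (f k).1, fun k => (f k).2.1, fun k => (f k).2.2.1, fun k => (f k).2.2.2,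
    fun k j h => (hR k j h).1, ?_, fun k => (hP k).1, fun k => (hP k).2.1, fun k => (hP k).2.2.1,
    fun k j => ?_, fun k j h => (hR k j h).2.2.2.2⟩
  · intro k j h
    rcases lt_trichotomy k j with hlt | heq | hlt
    · exact absurd h (hR k j hlt).2.1
    · exact heq
    · exact absurd h.symm (hR j k hlt).2.1
  · rcases lt_trichotomy k j with hlt | rfl | hlt
    · rw [max_eq_right hlt.le]; exact (hR k j hlt).2.2.1
    · rw [max_self]; exact (hP k).2.2.2
    · rw [max_eq_left hlt.le]; exact (hR j k hlt).2.2.2.1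

theorem exists_seq_tendsto_zero_of_countable (N : Type*) [AddCommGroup N] [Infinite N]
    [Countable N] :
    ∃ x : ℕ → N, Function.Injective x ∧
      (∀ y ≠ 0, ∃ χ : N →+ UnitAddCircle, χ y ≠ 0 ∧ Tendsto (fun k => χ (x k)) atTop (𝓝 0)) ∧
      ∃ h : Set ℕ → (N →+ UnitAddCircle), Function.Injective h ∧
        ∀ S, Tendsto (fun k => h S (x k)) atTop (𝓝 0) := by
  classical
  obtain ⟨g, hg⟩ := exists_surjective_nat N
  have hc : ∀ j, ∃ χ : N →+ UnitAddCircle, g j ≠ 0 → χ (g j) ≠ 0 := fun j => by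
    by_cases h : g j = 0
    · exact ⟨0, fun h' => absurd h h'⟩
    · obtain ⟨χ, hχ⟩ := exists_addMonoidHom_unitAddCircle_ne_zero h
      exact ⟨χ, fun _ => hχ⟩
  choose c hc using hc
  obtain ⟨n, x, a, w, hn, hx, haw, hcx, hag, hax, haw'⟩ := exists_rapid_sequence g c
  have hpow : ∀ {m k : ℕ}, m ≤ k → (1 / 4 : ℝ) ^ n k ≤ (1 / 4) ^ m := fun h =>
    pow_le_pow_of_le_one (by norm_num) (by norm_num) (h.trans hn.le_apply)
  have hgeom : Summable fun k : ℕ => (1 / 4 : ℝ) ^ k :=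
    summable_geometric_of_lt_one (by norm_num) (by norm_num)
  have hgeom0 : Tendsto (fun k : ℕ => (1 / 4 : ℝ) ^ k) atTop (𝓝 0) :=
    tendsto_pow_atTop_nhds_zero_of_lt_one (by norm_num) (by norm_num)
  have hite : ∀ (S : Set ℕ) k y, ‖if k ∈ S then a k y else 0‖ ≤ ‖a k y‖ := fun S k y => by
    split_ifs <;> simp
  have hsum : ∀ (S : Set ℕ) y, Summable fun k => if k ∈ S then a k y else 0 := by
    intro S y
    obtain ⟨j, rfl⟩ := hg y
    refine Summable.of_norm_bounded_eventually_nat hgeom ?_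
    filter_upwards [eventually_ge_atTop j] with k hk
    exact (hite S k _).trans ((hag k j (hk.trans hn.le_apply)).trans (hpow le_rfl))
  -- Subseries of the characters `a k`. At each fixed point the terms are eventually dominated by a
  -- geometric series.
  let h : Set ℕ → (N →+ UnitAddCircle) := fun S => AddMonoidHom.mk'
    (fun y => ∑' k, if k ∈ S then a k y else 0) fun y z => by
      rw [← (hsum S y).tsum_add (hsum S z)]
      refine tsum_congr fun k => ?_
      split_ifs <;> simp
  refine ⟨x, hx, fun y hy => ?_, h, fun S S' hSS' => ?_, fun S => ?_⟩
  · obtain ⟨j, rfl⟩ := hg y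
    refine ⟨c j, hc j hy, squeeze_zero_norm' ?_ hgeom0⟩
    filter_upwards [eventually_ge_atTop j] with k hk
    exact (hcx k j (hk.trans hn.le_apply)).trans (hpow le_rfl)
  · by_contra hne
    have hex : ∃ k, ¬ (k ∈ S ↔ k ∈ S') := by
      contrapose! hne
      exact Set.ext hne
    -- At `w k`, for the first index where the sets differ, the tail has total norm below that of
    -- the `k`-th term and cannot cancel it.
    let k := Nat.find hex
    have hk : ¬ (k ∈ S ↔ k ∈ S') := Nat.find_spec hex
    have hmin : ∀ m < k, (m ∈ S ↔ m ∈ S') := fun m hm => not_not.mp (Nat.find_min hex hm)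
    let d : ℕ → UnitAddCircle := fun m =>
      (if m ∈ S then a m (w k) else 0) - if m ∈ S' then a m (w k) else 0
    have hd : Summable d := (hsum S _).sub (hsum S' _)
    have hd0 : ∑' m, d m = 0 := by
      rw [(hsum S _).tsum_sub (hsum S' _), sub_eq_zero]
      exact DFunLike.congr_fun hSS' (w k)
    have hdle : ∀ m, ‖d m‖ ≤ ‖a m (w k)‖ := fun m => by
      simp only [d]
      split_ifs <;> simp
    have hdk : ‖d k‖ = ‖a k (w k)‖ := by
      simp only [d]
      by_cases h1 : k ∈ S <;> by_cases h2 : k ∈ S' <;> simp_all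
    have hfirst : ∑ m ∈ Finset.range (k + 1), d m = d k := by
      rw [Finset.sum_range_succ, Finset.sum_eq_zero, zero_add]
      intro m hm
      simp only [d, hmin m (Finset.mem_range.mp hm), sub_self]
    have htail := tsum_norm_lt_of_quarter_pow (d := fun m => d (m + (k + 1)))
      (norm_pos_iff.mpr (haw k)) fun m => by
        refine (hdle _).trans ((haw' k (m + (k + 1)) (by omega)).trans ?_)
        exact mul_le_mul_of_nonneg_right (hpow (by omega)) (norm_nonneg _)
    have htot := hd.sum_add_tsum_nat_add (k + 1)
    rw [hd0, hfirst, add_eq_zero_iff_eq_neg'] at htot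
    rw [htot, norm_neg, hdk] at htail
    exact lt_irrefl _ htail
  · have := tendsto_tsum_of_dominated_convergence (𝓕 := atTop)
      (f := fun j k => if k ∈ S then a k (x j) else 0) (g := fun _ => 0) hgeom (fun k => ?_)
      (Eventually.of_forall fun j k => (hite S k _).trans ((hax k j).trans
        (hpow (le_max_left _ _))))
    · rw [tsum_zero] at this
      exact this
    · refine squeeze_zero_norm (fun j => (hite S k _).trans ((hax k j).trans
        (hpow (le_max_right _ _)))) hgeom0

/-! ### Null characters of an arbitrary infinite group -/

theorem le_mk_quotient {X : Type u} [AddCommGroup X] (A : AddSubgroup X) {κ : Cardinal.{u}}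
    (hκ : ℵ₀ ≤ κ) (hX : κ ≤ #X) (hA : #A < κ) : κ ≤ #(X ⧸ A) := by
  by_contra! hlt
  refine hX.not_gt ?_
  rw [Cardinal.mk_congr AddSubgroup.addGroupEquivQuotientProdAddSubgroup, Cardinal.mk_prod,
    Cardinal.lift_id, Cardinal.lift_id]
  exact Cardinal.mul_lt_of_lt hκ hlt hA

/-- The characters of `G` along which the sequence `x` converges to zero. -/
def nullCharacters {G : Type u} [AddCommGroup G] (x : ℕ → G) :
    AddSubgroup (G →+ UnitAddCircle) where
  carrier := {χ | Tendsto (fun n => χ (x n)) atTop (𝓝 0)}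
  zero_mem' := tendsto_const_nhds
  add_mem' := fun h h' => by simpa using Tendsto.add h h'
  neg_mem' := fun h => by simpa using Tendsto.neg h

theorem tendsto_charTopology {G : Type u} [AddCommGroup G] {x : ℕ → G}
    {A : AddSubgroup (G →+ UnitAddCircle)} (hA : A ≤ nullCharacters x) :
    Tendsto x atTop (@nhds G (charTopology A) 0) := by
  rw [nhds_induced, tendsto_comap_iff, tendsto_pi_nhds]
  intro χ
  have h : Tendsto (fun n => χ.1 (x n)) atTop (𝓝 0) := hA χ.2
  simpa using h

theorem exists_injective_seq_nullCharacters (G : Type u) [AddCommGroup G] [Infinite G] :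
    ∃ x : ℕ → G, Function.Injective x ∧ (∀ g ≠ 0, ∃ χ ∈ nullCharacters x, χ g ≠ 0) ∧
      (2 : Cardinal.{u}) ^ #G ≤ #(nullCharacters x) := by
  let ν := Infinite.natEmbedding G
  let N := AddSubgroup.closure (Set.range ν)
  have hNc : #N ≤ ℵ₀ := (mk_closure_le _).trans
    (max_le le_rfl (Set.countable_range ν).le_aleph0)
  have : Countable N := Cardinal.mk_le_aleph0_iff.mp hNc
  have : Infinite N := Infinite.of_injective
    (fun k => (⟨ν k, AddSubgroup.subset_closure ⟨k, rfl⟩⟩ : N))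
    fun a b h => ν.injective (Subtype.mk.inj h)
  obtain ⟨x, hx, hsep, h, hinj, hh⟩ := exists_seq_tendsto_zero_of_countable N
  have hext : ∀ χ : N →+ UnitAddCircle, ∃ ψ : G →+ UnitAddCircle, ∀ y : N, ψ y = χ y := fun χ =>
    let ⟨ψ, hψ⟩ := exists_addMonoidHom_extension N.subtype N.subtype_injective χ
    ⟨ψ, fun y => DFunLike.congr_fun hψ y⟩
  have hquot : ∀ χ : G ⧸ N →+ UnitAddCircle,
      χ.comp (QuotientAddGroup.mk' N) ∈ nullCharacters (fun k => (x k : G)) := by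
    intro χ
    have : ∀ k, χ.comp (QuotientAddGroup.mk' N) (x k : G) = 0 := fun k => by
      have h0 : QuotientAddGroup.mk' N (x k : G) = 0 := (QuotientAddGroup.eq_zero_iff _).mpr (x k).2
      rw [AddMonoidHom.comp_apply, h0, map_zero]
    change Tendsto _ _ _
    simp_rw [this]
    exact tendsto_const_nhds
  refine ⟨fun k => x k, Subtype.val_injective.comp hx, fun g hg => ?_, ?_⟩
  · by_cases hgN : g ∈ N
    · obtain ⟨χ, hχ, hχx⟩ := hsep ⟨g, hgN⟩ (by simpa [Subtype.ext_iff] using hg)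
      obtain ⟨ψ, hψ⟩ := hext χ
      refine ⟨ψ, ?_, by rwa [← hψ] at hχ⟩
      simp_rw [← hψ] at hχx
      exact hχx
    · have hg' : QuotientAddGroup.mk' N g ≠ 0 := fun h0 =>
        hgN ((QuotientAddGroup.eq_zero_iff _).mp h0)
      obtain ⟨χ, hχ⟩ := exists_addMonoidHom_unitAddCircle_ne_zero hg'
      exact ⟨_, hquot χ, hχ⟩
  -- For uncountable `G` the quotient by `N` supplies enough characters; for countable `G` the
  -- subseries `h` do.
  · rcases (Cardinal.aleph0_le_mk G).lt_or_eq with hG | hG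
    · have hGN : #G ≤ #(G ⧸ N) := le_mk_quotient N hG.le le_rfl (hNc.trans_lt hG)
      refine (Cardinal.power_le_power_left two_ne_zero hGN).trans
        ((two_power_mk_le_mk_addMonoidHom _ (hG.trans_le hGN)).trans ?_)
      refine Cardinal.mk_le_of_injective (f := fun χ => ⟨_, hquot χ⟩) fun χ χ' hχ => ?_
      exact QuotientAddGroup.addMonoidHom_ext _ (Subtype.mk.inj hχ)
    · have : Countable G := Cardinal.mk_le_aleph0_iff.mp hG.ge
      obtain ⟨j, hj⟩ := exists_injective_nat G
      choose ψ hψ using hext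
      rw [← Cardinal.mk_set]
      refine Cardinal.mk_le_of_injective (f := fun S => ⟨ψ (h (j '' S)), ?_⟩) fun S S' hS => ?_
      · change Tendsto _ _ _
        simp_rw [hψ]
        exact hh _
      · refine hj.image_injective (hinj (AddMonoidHom.ext fun y => ?_))
        rw [← hψ, ← hψ]
        exact DFunLike.congr_fun (Subtype.mk.inj hS) _

/-! ### Many large separating subgroups -/

theorem mem_span_image_iff_of_iSupIndep {Q ι : Type*} [AddCommGroup Q] {q : ι → Q}
    (hq0 : ∀ i, q i ≠ 0) (hq : iSupIndep fun i => Submodule.span ℤ {q i}) {i : ι} {J : Set ι} :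
    q i ∈ Submodule.span ℤ (q '' J) ↔ i ∈ J := by
  refine ⟨fun h => ?_, fun h => Submodule.subset_span ⟨i, h, rfl⟩⟩
  by_contra hi
  have hle : Submodule.span ℤ (q '' J) ≤ ⨆ j, ⨆ _ : j ≠ i, Submodule.span ℤ {q j} := by
    rw [Submodule.span_le]
    rintro _ ⟨j, hj, rfl⟩
    have hji : j ≠ i := fun h => hi (h ▸ hj)
    exact le_iSup₂ (f := fun j (_ : j ≠ i) => Submodule.span ℤ {q j}) j hji
      (Submodule.mem_span_singleton_self _)
  exact hq0 i (Submodule.disjoint_def.mp (hq i) _ (Submodule.mem_span_singleton_self _) (hle h))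

theorem exists_family_separating_subgroups {G : Type u} [AddCommGroup G] [Infinite G]
    (H : AddSubgroup (G →+ UnitAddCircle)) (hsep : ∀ g ≠ 0, ∃ χ ∈ H, χ g ≠ 0)
    (hH : (2 : Cardinal.{u}) ^ #G ≤ #H) :
    ∃ Θ : Set (Set G) → AddSubgroup (G →+ UnitAddCircle), Function.Injective Θ ∧
      ∀ S, Θ S ≤ H ∧ (∀ g ≠ 0, ∃ χ ∈ Θ S, χ g ≠ 0) ∧ (2 : Cardinal.{u}) ^ #G ≤ #(Θ S) := by
  classical
  have hG : ℵ₀ ≤ #G := Cardinal.aleph0_le_mk G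
  have hG2 : #G < 2 ^ #G := Cardinal.cantor _
  have hk : ∀ g : G, ∃ χ : H, g ≠ 0 → χ.1 g ≠ 0 := fun g => by
    by_cases hg : g = 0
    · exact ⟨0, fun h => absurd hg h⟩
    · obtain ⟨χ, hχ, h⟩ := hsep g hg
      exact ⟨⟨χ, hχ⟩, fun _ => h⟩
  choose k hk using hk
  -- Every subgroup built below contains `A`, which secures separation of points; `A` is small
  -- enough that the quotient keeps size at least `2 ^ #G`.
  let A := AddSubgroup.closure (Set.range k)
  have hA : #A < 2 ^ #G :=
    ((mk_closure_le _).trans (max_le hG Cardinal.mk_range_le)).trans_lt hG2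
  have hQ : 2 ^ #G ≤ #(H ⧸ A) := le_mk_quotient A (hG.trans hG2.le) hH hA
  obtain ⟨f, hf0, hf⟩ := exists_iSupIndep_span_singleton (H ⧸ A) ((hG.trans_lt hG2).trans_le hQ)
  have hcard : #(Set G × Bool) ≤ #(H ⧸ A) := by
    refine le_trans (le_of_eq ?_) hQ
    rw [Cardinal.mk_prod, Cardinal.mk_set, Cardinal.lift_uzero, Cardinal.mk_bool,
      Cardinal.lift_two]
    exact Cardinal.mul_eq_left (hG.trans hG2.le)
      ((Cardinal.natCast_lt_aleph0 (n := 2)).le.trans (hG.trans hG2.le)) two_ne_zero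
  obtain ⟨i⟩ := hcard
  let q : Set G × Bool → H ⧸ A := f ∘ i
  have hmem : ∀ {p : Set G × Bool} {J : Set (Set G × Bool)},
      q p ∈ Submodule.span ℤ (q '' J) ↔ p ∈ J :=
    mem_span_image_iff_of_iSupIndep (fun p => hf0 _) (hf.comp i.injective)
  have hqinj : Function.Injective q := fun p p' h =>
    (hmem (J := {p'})).mp (by rw [Set.image_singleton, h]; exact Submodule.mem_span_singleton_self _)
  -- Exactly one of two labels is kept for each `s`, so `J S` determines `S` yet always has `2 ^ #G`
  -- elements.
  let J : Set (Set G) → Set (Set G × Bool) := fun S => {p | p.2 = decide (p.1 ∈ S)}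
  have hJ : Function.Injective J := fun S S' h => by
    ext s
    have : (s, true) ∈ J S ↔ (s, true) ∈ J S' := by rw [h]
    simpa [J] using this
  let C : Set (Set G) → AddSubgroup (H ⧸ A) := fun S => (Submodule.span ℤ (q '' J S)).toAddSubgroup
  have hC : Function.Injective C := fun S S' h => hJ <| by
    ext p
    rw [← hmem (J := J S), ← hmem (J := J S')]
    exact SetLike.ext_iff.mp h (q p)
  refine ⟨fun S => ((C S).comap (QuotientAddGroup.mk' A)).map H.subtype,
    (AddSubgroup.map_injective H.subtype_injective).comp
      ((AddSubgroup.comap_injective (QuotientAddGroup.mk'_surjective A)).comp hC),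
    fun S => ⟨?_, fun g hg => ⟨k g, ?_, hk g hg⟩, ?_⟩⟩
  · rintro _ ⟨χ, -, rfl⟩
    exact χ.2
  · refine ⟨k g, ?_, rfl⟩
    have h0 : QuotientAddGroup.mk' A (k g) = 0 :=
      (QuotientAddGroup.eq_zero_iff _).mpr (AddSubgroup.subset_closure ⟨g, rfl⟩)
    change QuotientAddGroup.mk' A (k g) ∈ C S
    rw [h0]
    exact (C S).zero_mem
  · rw [← Cardinal.mk_set]
    choose r hr using QuotientAddGroup.mk'_surjective A
    have hrC : ∀ s : Set G, r (q (s, decide (s ∈ S))) ∈ (C S).comap (QuotientAddGroup.mk' A) :=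
      fun s => by
        change QuotientAddGroup.mk' A _ ∈ C S
        rw [hr]
        exact Submodule.subset_span ⟨_, rfl, rfl⟩
    refine Cardinal.mk_le_of_injective
      (f := fun s => ⟨(r (q (s, decide (s ∈ S)))).1, ⟨_, hrC s, rfl⟩⟩) fun s s' hs => ?_
    have h1 : r (q (s, decide (s ∈ S))) = r (q (s', decide (s' ∈ S))) :=
      Subtype.ext (Subtype.mk.inj hs)
    have h2 := congrArg (QuotientAddGroup.mk' A) h1
    rw [hr, hr] at h2
    exact congrArg Prod.fst (hqinj h2)

/-! ### Counting homeomorphism classes -/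

/-- Topologies on `G` up to homeomorphism. -/
def homeomorphSetoid (G : Type u) : Setoid (TopologicalSpace G) where
  r T₀ T₁ := Nonempty (@Homeomorph G G T₀ T₁)
  iseqv :=
    { refl := fun T => ⟨@Homeomorph.refl G T⟩
      symm := fun {T T'} ⟨e⟩ => ⟨@Homeomorph.symm G G T T' e⟩
      trans := fun {T T' T''} ⟨e⟩ ⟨e'⟩ => ⟨@Homeomorph.trans G G G T T' T'' e e'⟩ }

/-- Within a class, a topology is determined by the permutation pulling the chosen representative
back to it. -/
theorem mk_le_mk_quotient_homeomorphSetoid_mul {G ι : Type u} (Θ : ι → TopologicalSpace G)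
    (hΘ : Function.Injective Θ) :
    #ι ≤ #(Quotient ((homeomorphSetoid G).comap Θ)) * #(G ≃ G) := by
  have he : ∀ i, ∃ e : G ≃ G, TopologicalSpace.induced e
      (Θ (Quotient.mk ((homeomorphSetoid G).comap Θ) i).out) = Θ i := fun i => by
    obtain ⟨e⟩ := (homeomorphSetoid G).symm
      (Quotient.mk_out (s := (homeomorphSetoid G).comap Θ) i)
    exact ⟨@Homeomorph.toEquiv _ _ (_) (_) e, @Homeomorph.induced_eq _ _ (_) (_) e⟩
  choose e he using he
  rw [← Cardinal.lift_id #(Quotient _), ← Cardinal.lift_id #(G ≃ G), ← Cardinal.mk_prod]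
  refine Cardinal.mk_le_of_injective
    (f := fun i => (Quotient.mk ((homeomorphSetoid G).comap Θ) i, e i))
    fun i j hij => hΘ ?_
  obtain ⟨h1, h2⟩ := Prod.mk.inj hij
  rw [← he i, ← he j, h1, h2]

theorem mk_perm_le_two_power (G : Type u) [Infinite G] : #(G ≃ G) ≤ 2 ^ #G := by
  refine (Cardinal.mk_le_of_injective (f := fun e : G ≃ G => (e : G → G))
    DFunLike.coe_injective).trans ?_
  rw [← Cardinal.power_def]
  exact (Cardinal.power_self_eq (Cardinal.aleph0_le_mk G)).le

theorem theorem5p5 (G : Type u) [AddCommGroup G] [Infinite G] :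
    ∃ x : ℕ → G, Function.Injective x ∧
      ∃ B : Set (TopologicalSpace G),
        #B = (2 : Cardinal.{u}) ^ ((2 : Cardinal.{u}) ^ #G) ∧
        (∀ T ∈ B, IsTotallyBoundedGroupTopology T ∧
          topWeight T = (2 : Cardinal.{u}) ^ #G ∧
          Tendsto x atTop (@nhds G T 0)) ∧
        (∀ T₀ ∈ B, ∀ T₁ ∈ B, T₀ ≠ T₁ → IsEmpty (@Homeomorph G G T₀ T₁)) := by
  obtain ⟨x, hx, hsep, hcard⟩ := exists_injective_seq_nullCharacters G
  obtain ⟨Θ, hΘinj, hΘ⟩ := exists_family_separating_subgroups _ hsep hcard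
  have hG : ℵ₀ ≤ #G := Cardinal.aleph0_le_mk G
  have hG2 : #G < 2 ^ #G := Cardinal.cantor _
  have hinj : Function.Injective fun S => charTopology (Θ S) := charTopology_injective.comp hΘinj
  let s := (homeomorphSetoid G).comap fun S => charTopology (Θ S)
  have hhom : ∀ c d : Quotient s,
      Nonempty (@Homeomorph G G (charTopology (Θ c.out)) (charTopology (Θ d.out))) → c = d :=
    fun c d h => Quotient.out_equiv_out.mp h
  refine ⟨x, hx, Set.range fun c : Quotient s => charTopology (Θ c.out), ?_, ?_, ?_⟩
  · rw [Cardinal.mk_range_eq (fun c : Quotient s => charTopology (Θ c.out))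
      (hinj.comp Quotient.out_injective)]
    have hset : #(Set (Set G)) = 2 ^ (2 : Cardinal.{u}) ^ #G := by
      rw [Cardinal.mk_set, Cardinal.mk_set]
    refine le_antisymm (hset ▸ Cardinal.mk_quotient_le) ?_
    -- Fewer classes, times at most `2 ^ #G` permutations, could not account for all `2 ^ 2 ^ #G`
    -- topologies.
    by_contra! hlt
    have h := mk_le_mk_quotient_homeomorphSetoid_mul _ hinj
    rw [hset] at h
    exact h.not_gt (Cardinal.mul_lt_of_lt (hG.trans (hG2.le.trans (Cardinal.cantor _).le)) hlt
      ((mk_perm_le_two_power G).trans_lt (Cardinal.cantor _)))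
  · rintro _ ⟨c, rfl⟩
    obtain ⟨hle, hsepΘ, hmk⟩ := hΘ c.out
    exact ⟨isTotallyBoundedGroupTopology_charTopology _ hsepΘ,
      le_antisymm (topWeight_le _) (hmk.trans
        (mk_le_topWeight_charTopology _ ((hG.trans_lt hG2).trans_le hmk))),
      tendsto_charTopology hle⟩
  · rintro _ ⟨c, rfl⟩ _ ⟨d, rfl⟩ hne
    rw [← not_nonempty_iff]
    intro h
    exact hne (by rw [hhom c d h])
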